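/- Let $(R,\mathfrak m)$ be a complete Noetherian local ring with residue field $k$, let $E$ be an injective hull of $k$, and write $M^\vee=\operatorname{Hom}_R(M,E)$; for a submodule $N\subseteq M$ view $(M/N)^\vee$ as the submodule of $M^\vee$ of maps that vanish on $N$. An interior operation $\mathrm i$ on Artinian $R$-modules assigns to each Artinian module $M$ a submodule $\mathrm i(M)\subseteq M$, compatibly with isomorphisms, such that $\mathrm i(L)\subseteq \mathrm i(M)$ for $L\subseteq M$ and $\mathrm i(\mathrm i(M))=\mathrm i(M)$. It is Nakayama if for all Artinian modules $A\subseteq B$, $\mathrm i(A:_B\mathfrak m)\subseteq A$ implies $\mathrm i(A)=\mathrm i(B)$. A residual closure operation $\mathrm{cl}$ on finitely generated $R$-modules assigns to each submodule $L$ of a finitely generated module $M$ a submodule $L^{\mathrm{cl}}_M$ with $L\subseteq L^{\mathrm{cl}}_M\subseteq M$, such that $(L^{\mathrm{cl}}_M)^{\mathrm{cl}}_M=L^{\mathrm{cl}}_M$, $L^{\mathrm{cl}}_M\subseteq N^{\mathrm{cl}}_M$ for $L\subseteq N\subseteq M$, and $(\ker q)^{\mathrm{cl}}_M=q^{-1}(0^{\mathrm{cl}}_P)$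 for every surjection $q:M\to P$ of finitely generated modules. It is dual to $\mathrm i$ if $0^{\mathrm{cl}}_M=\bigl(M^\vee/\mathrm i(M^\vee)\bigr)^\vee$, taken as a submodule of $M$ along the evaluation map $M\to M^{\vee\vee}$, for every finitely generated $M$. Let $\mathrm i$ be a Nakayama interior on Artinian $R$-modules. Then a residual closure operation $\mathrm{cl}$ on finitely generated $R$-modules dual to $\mathrm i$ exists. Moreover, for any such $\mathrm{cl}$ and all Artinian $R$-modules $A\subseteq B$, the evaluation map $B\to B^{\vee\vee}$ is an isomorphism, and under this identification \[ \bigl(B^\vee/\mathrm{cl}\text{-core}_{B^\vee}((B/A)^\vee)\bigr)^\vee=\mathrm i\text{-hull}^B(A). \] Here $\mathrm i\text{-hull}^B(A)$ is the sum of all $\mathrm i$-expansions of $A$ in $B$, i.e. of all modules $C$ with $A\subseteq C\subseteq B$ and $\mathrm i(C)=\mathrm i(A)$, and $\mathrm{cl}\text{-core}_M(N)$ is the intersection of all $\mathrm{cl}$-reductions of $N$ in $M$, i.e. of all submodules $L\subseteq N$ with $L^{\mathrm{cl}}_M=N^{\mathrm{cl}}_M$. -/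

import Mathlib

universe u

namespace CoreHull

/-- `E` is an injective hull of the `R`-module `K`: `E` is injective and an essential extension
of a copy of `K`. -/
def IsInjectiveHull (R : Type u) [CommRing R] (K : Type u) [AddCommGroup K] [Module R K]
    (E : Type u) [AddCommGroup E] [Module R E] : Prop :=
  Module.Injective R E ∧
    ∃ ι : K →ₗ[R] E, Function.Injective ι ∧
      ∀ N : Submodule R E, N ≠ ⊥ → LinearMap.range ι ⊓ N ≠ ⊥

section Matlis

variable {R : Type u} [CommRing R] (E : Type u) [AddCommGroup E] [Module R E]

/-- The dual `M^∨ = Hom_R(M, E)` (the Matlis dual when `E` is the injective hull of the residue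
field of a local ring). -/
abbrev MatlisDual (M : Type u) [AddCommGroup M] [Module R M] : Type u := M →ₗ[R] E

/-- The evaluation map `M → M^∨∨`. -/
def biduality (M : Type u) [AddCommGroup M] [Module R M] :
    M →ₗ[R] MatlisDual (R := R) E (MatlisDual (R := R) E M) :=
  LinearMap.applyₗ

/-- `(M/N)^∨` viewed as a submodule of `M^∨`, through the dual of the projection `M → M/N`. -/
def quotientDual {M : Type u} [AddCommGroup M] [Module R M] (N : Submodule R M) :
    Submodule R (MatlisDual (R := R) E M) :=
  LinearMap.range (LinearMap.lcomp R E N.mkQ)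

end Matlis

/-- An assignment `M ↦ α(M) ⊆ M`. It is defined on all modules for convenience; the laws below are
imposed only on the class of modules on which the operation is considered, and the values outside
that class play no role. -/
abbrev Selector (R : Type u) [CommRing R] : Type (u + 1) :=
  ∀ (M : Type u) [AddCommGroup M] [Module R M], Submodule R M

/-- An assignment `(L ⊆ M) ↦ L^cl_M ⊆ M`, with the same convention about its domain. -/
abbrev ClosureAssignment (R : Type u) [CommRing R] : Type (u + 1) :=
  ∀ (M : Type u) [AddCommGroup M] [Module R M], Submodule R M → Submodule R M

section Operations

variable {R : Type u} [CommRing R]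

/-- `i` is an interior operation on the class of Artinian `R`-modules: a submodule selector
(compatible with isomorphisms) that is order-preserving and idempotent. -/
structure IsInteriorOnArtinian (i : Selector R) : Prop where
  map_equiv : ∀ (M N : Type u) [AddCommGroup M] [Module R M] [AddCommGroup N] [Module R N]
    [IsArtinian R M] [IsArtinian R N] (e : M ≃ₗ[R] N),
    (i M).map (e : M →ₗ[R] N) = i N
  mono : ∀ (M : Type u) [AddCommGroup M] [Module R M] [IsArtinian R M] (L : Submodule R M),
    (i L).map L.subtype ≤ i M
  idem : ∀ (M : Type u) [AddCommGroup M] [Module R M] [IsArtinian R M],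
    (i (i M)).map (i M).subtype = i M

/-- `(A :_B I) = {b ∈ B | I b ⊆ A}`. -/
def colonIn {B : Type u} [AddCommGroup B] [Module R B] (A : Submodule R B) (I : Ideal R) :
    Submodule R B where
  carrier := {b | ∀ r ∈ I, r • b ∈ A}
  zero_mem' := fun r _ => by simp
  add_mem' := fun hx hy r hr => by
    rw [smul_add]
    exact A.add_mem (hx r hr) (hy r hr)
  smul_mem' := fun c x hx r hr => by
    rw [smul_comm]
    exact A.smul_mem c (hx r hr)

/-- `i` is a Nakayama interior on Artinian `R`-modules: it is an interior operation and, for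
Artinian modules `A ⊆ B`, `i(A :_B 𝔪) ⊆ A` implies `i(A) = i(B)`. -/
structure IsNakayamaInterior [IsLocalRing R] (i : Selector R) : Prop
    extends IsInteriorOnArtinian i where
  nakayama : ∀ (B : Type u) [AddCommGroup B] [Module R B] [IsArtinian R B] (A : Submodule R B),
    (i (colonIn A (IsLocalRing.maximalIdeal R))).map
        (colonIn A (IsLocalRing.maximalIdeal R)).subtype ≤ A →
      (i A).map A.subtype = i B

/-- `cl` is a residual closure operation on the class of finitely generated `R`-modules. -/
structure IsResidualClosureOnFinite (cl : ClosureAssignment R) : Prop where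
  le_cl : ∀ (M : Type u) [AddCommGroup M] [Module R M] [Module.Finite R M] (L : Submodule R M),
    L ≤ cl M L
  idem : ∀ (M : Type u) [AddCommGroup M] [Module R M] [Module.Finite R M] (L : Submodule R M),
    cl M (cl M L) = cl M L
  mono : ∀ (M : Type u) [AddCommGroup M] [Module R M] [Module.Finite R M] (L N : Submodule R M),
    L ≤ N → cl M L ≤ cl M N
  residual : ∀ (M P : Type u) [AddCommGroup M] [Module R M] [AddCommGroup P] [Module R P]
    [Module.Finite R M] [Module.Finite R P] (q : M →ₗ[R] P), Function.Surjective q →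
    cl M (LinearMap.ker q) = (cl P ⊥).comap q

/-- The dual selector `α^⌣(M) = (M^∨ / α(M^∨))^∨`, a submodule of `M^∨∨`, pulled back to `M` along
the evaluation map `M → M^∨∨`. -/
def dualSelector (E : Type u) [AddCommGroup E] [Module R E] (α : Selector R) : Selector R :=
  fun M _ _ => (quotientDual (R := R) E (α (MatlisDual (R := R) E M))).comap (biduality E M)

/-- `cl` is the closure operation dual to `i`: the residual closure operation on finitely generated
modules with `0^cl_M = i^⌣(M)` for every finitely generated `M`. -/
structure IsDualClosure (E : Type u) [AddCommGroup E] [Module R E] (i : Selector R)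
    (cl : ClosureAssignment R) : Prop extends IsResidualClosureOnFinite cl where
  cl_bot : ∀ (M : Type u) [AddCommGroup M] [Module R M] [Module.Finite R M],
    cl M ⊥ = dualSelector E i M

/-- `C` is an `i`-expansion of `A` in `B`: `A ⊆ C ⊆ B` and `i(A) = i(C)`. -/
def IsExpansion (i : Selector R) {B : Type u} [AddCommGroup B] [Module R B]
    (A C : Submodule R B) : Prop :=
  A ≤ C ∧ (i A).map A.subtype = (i C).map C.subtype

/-- The `i`-hull of `A` in `B`: the sum of all `i`-expansions of `A` in `B`. -/
def hull (i : Selector R) {B : Type u} [AddCommGroup B] [Module R B]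
    (A : Submodule R B) : Submodule R B :=
  sSup {C | IsExpansion i A C}

/-- `L` is a `cl`-reduction of `N` in `M`: `L ⊆ N ⊆ M` and `L^cl_M = N^cl_M`. -/
def IsReduction (cl : ClosureAssignment R) {M : Type u} [AddCommGroup M] [Module R M]
    (N L : Submodule R M) : Prop :=
  L ≤ N ∧ cl M L = cl M N

/-- The `cl`-core of `N` in `M`: the intersection of all `cl`-reductions of `N` in `M`. -/
def core (cl : ClosureAssignment R) {M : Type u} [AddCommGroup M] [Module R M]
    (N : Submodule R M) : Submodule R M :=
  sInf {L | IsReduction cl N L}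

end Operations

end CoreHull

/-!
Matlis duality makes `N ↦ (M/N)^∨` an inclusion-reversing bijection from the submodules of `M` to
those of `M^∨` whenever `M` is finitely generated or Artinian. Residuality and `0^cl_M = i^⌣(M)`
force `L^cl_M` to be the common kernel of the maps in `i((M/L)^∨) ⊆ M^∨`, and this formula does
define a residual closure. Consequently the closure of `(B/C)^∨` in `B^∨` is `(B/i(C))^∨`, so `C` is
an `i`-expansion of `A` if and only if `(B/C)^∨` is a `cl`-reduction of `(B/A)^∨`; the bijection
then exchanges the sum of the expansions with the intersection of the reductions.

For the duality itself, the class of modules with surjective evaluation map contains the residue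
field and is closed under quotients and extensions. Hence it contains every `R/𝔪ⁿ`, which says that
an endomorphism of `E` is a homothety on the part of `E` killed by `𝔪ⁿ`. Completeness glues these
homotheties, so that `R → End E` is surjective.
-/

namespace CoreHull

section Annihilators

variable {R : Type u} [CommRing R] {E : Type u} [AddCommGroup E] [Module R E]
  {M : Type u} [AddCommGroup M] [Module R M] {P : Type u} [AddCommGroup P] [Module R P]

@[simp]
theorem biduality_apply (x : M) (f : MatlisDual (R := R) E M) : biduality E M x f = f x := rfl

theorem biduality_surjective_of_subsingleton [Subsingleton M] :
    Function.Surjective (biduality (R := R) E M) := fun F =>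
  ⟨0, LinearMap.ext fun f => by rw [Subsingleton.elim f 0, map_zero, map_zero]⟩

theorem mem_quotientDual {N : Submodule R M} {f : MatlisDual (R := R) E M} :
    f ∈ quotientDual E N ↔ ∀ x ∈ N, f x = 0 := by
  constructor
  · rintro ⟨g, rfl⟩ x hx
    rw [LinearMap.lcomp_apply, N.mkQ_apply, (Submodule.Quotient.mk_eq_zero N).2 hx, map_zero]
  · exact fun h => ⟨N.liftQ f h, N.liftQ_mkQ f h⟩

theorem range_lcomp_of_surjective {q : M →ₗ[R] P} (hq : Function.Surjective q) :
    LinearMap.range (LinearMap.lcomp R E q) = quotientDual E (LinearMap.ker q) := by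
  have hexact := LinearMap.exact_lcomp_of_exact_of_surjective E
    (LinearMap.exact_subtype_ker_map q) hq
  ext f
  rw [← LinearMap.exact_iff.1 hexact, LinearMap.mem_ker, mem_quotientDual, LinearMap.ext_iff,
    Subtype.forall]
  rfl

/-- The common kernel in `M` of a module `D` of maps `M → E`, that is, `(M^∨/D)^∨` pulled back
along the evaluation map `M → M^∨∨`. -/
def coannihilator (D : Submodule R (MatlisDual (R := R) E M)) : Submodule R M :=
  (quotientDual E D).comap (biduality E M)

theorem mem_coannihilator {D : Submodule R (MatlisDual (R := R) E M)} {x : M} :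
    x ∈ coannihilator D ↔ ∀ f ∈ D, f x = 0 :=
  mem_quotientDual

theorem le_quotientDual_iff {D : Submodule R (MatlisDual (R := R) E M)} {N : Submodule R M} :
    D ≤ quotientDual E N ↔ N ≤ coannihilator D :=
  ⟨fun h _ hx => mem_coannihilator.2 fun _ hf => mem_quotientDual.1 (h hf) _ hx,
    fun h _ hf => mem_quotientDual.2 fun _ hx => mem_coannihilator.1 (h hx) _ hf⟩

theorem quotientDual_antitone :
    Antitone (quotientDual E : Submodule R M → Submodule R (MatlisDual (R := R) E M)) :=
  fun _ _ h => le_quotientDual_iff.2 (h.trans (le_quotientDual_iff.1 le_rfl))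

theorem coannihilator_antitone :
    Antitone (coannihilator : Submodule R (MatlisDual (R := R) E M) → Submodule R M) :=
  fun _ _ h => le_quotientDual_iff.1 (h.trans (le_quotientDual_iff.2 le_rfl))

theorem coannihilator_map_biduality (N : Submodule R M) :
    coannihilator (N.map (biduality E M)) = quotientDual E N := by
  ext f
  simp only [mem_coannihilator, mem_quotientDual, Submodule.mem_map, forall_exists_index, and_imp,
    forall_apply_eq_imp_iff₂, biduality_apply]

theorem coannihilator_map_lcomp (q : M →ₗ[R] P) (D : Submodule R (MatlisDual (R := R) E P)) :
    coannihilator (D.map (LinearMap.lcomp R E q)) = (coannihilator D).comap q := by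
  ext x
  simp only [mem_coannihilator, Submodule.mem_comap, Submodule.mem_map, forall_exists_index,
    and_imp, forall_apply_eq_imp_iff₂, LinearMap.lcomp_apply]

end Annihilators

section Cogenerator

variable {R : Type u} [CommRing R] {E : Type u} [AddCommGroup E] [Module R E]
  {M : Type u} [AddCommGroup M] [Module R M]

/-- `E` is a cogenerator: the maps to `E` separate the points of every module. -/
def IsCogenerator (R : Type u) [CommRing R] (E : Type u) [AddCommGroup E] [Module R E] : Prop :=
  ∀ (M : Type u) [AddCommGroup M] [Module R M] (x : M), x ≠ 0 → ∃ f : M →ₗ[R] E, f x ≠ 0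

namespace IsCogenerator

theorem biduality_injective (hE : IsCogenerator R E) :
    Function.Injective (biduality (R := R) E M) := by
  refine (injective_iff_map_eq_zero _).2 fun x hx => ?_
  by_contra h
  obtain ⟨f, hf⟩ := hE M x h
  exact hf (LinearMap.congr_fun hx f)

theorem coannihilator_quotientDual (hE : IsCogenerator R E) (N : Submodule R M) :
    coannihilator (quotientDual E N) = N := by
  refine le_antisymm (fun x hx => ?_) (le_quotientDual_iff.1 le_rfl)
  by_contra h
  obtain ⟨f, hf⟩ := hE (M ⧸ N) (N.mkQ x) ((Submodule.Quotient.mk_eq_zero N).not.2 h)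
  exact hf (mem_coannihilator.1 hx (f ∘ₗ N.mkQ) ⟨f, rfl⟩)

theorem quotientDual_injective (hE : IsCogenerator R E) :
    Function.Injective
      (quotientDual E : Submodule R M → Submodule R (MatlisDual (R := R) E M)) :=
  Function.LeftInverse.injective hE.coannihilator_quotientDual

theorem quotientDual_le_quotientDual_iff (hE : IsCogenerator R E) {N N' : Submodule R M} :
    quotientDual E N ≤ quotientDual E N' ↔ N' ≤ N := by
  rw [le_quotientDual_iff, hE.coannihilator_quotientDual]

theorem quotientDual_coannihilator (hE : IsCogenerator R E)
    (hM : Function.Surjective (biduality (R := R) E M))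
    (D : Submodule R (MatlisDual (R := R) E M)) : quotientDual E (coannihilator D) = D :=
  calc quotientDual E (coannihilator D)
      = coannihilator ((coannihilator D).map (biduality E M)) :=
        (coannihilator_map_biduality _).symm
    _ = coannihilator (quotientDual E D) :=
        congrArg _ (Submodule.map_comap_eq_of_surjective hM _)
    _ = D := hE.coannihilator_quotientDual D

theorem quotientDual_quotientDual (hE : IsCogenerator R E)
    (hM : Function.Surjective (biduality (R := R) E M)) (N : Submodule R M) :
    quotientDual E (quotientDual E N) = N.map (biduality E M) := by
  rw [← Submodule.map_comap_eq_of_surjective hM (quotientDual E (quotientDual E N))]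
  exact congrArg _ (hE.coannihilator_quotientDual N)

theorem isArtinian_dual (hE : IsCogenerator R E) [IsNoetherian R M]
    (hM : Function.Surjective (biduality (R := R) E M)) :
    IsArtinian R (MatlisDual (R := R) E M) :=
  (coannihilator_antitone.strictAnti_of_injective
    (Function.LeftInverse.injective (hE.quotientDual_coannihilator hM))).wellFoundedLT

theorem biduality_surjective_of_dual (hE : IsCogenerator R E)
    (hM : Function.Surjective (biduality (R := R) E (MatlisDual (R := R) E M))) :
    Function.Surjective (biduality (R := R) E M) := by
  have hbot : coannihilator (LinearMap.range (biduality (R := R) E M)) = ⊥ :=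
    (Submodule.eq_bot_iff _).2 fun f hf =>
      LinearMap.ext fun x => mem_coannihilator.1 hf _ ⟨x, rfl⟩
  rw [← LinearMap.range_eq_top, ← hE.quotientDual_coannihilator hM (LinearMap.range _), hbot,
    eq_top_iff, le_quotientDual_iff]
  exact bot_le

theorem mem_of_forall_smul_eq_zero (hE : IsCogenerator R E) {I : Ideal R} {r : R}
    (h : ∀ x : E, (∀ s ∈ I, s • x = 0) → r • x = 0) : r ∈ I := by
  rw [← hE.coannihilator_quotientDual I, mem_coannihilator]
  intro f hf
  have hsmul (s : R) : f s = s • f 1 := by rw [← map_smul, smul_eq_mul, mul_one]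
  exact (hsmul r).trans (h _ fun s hs => (hsmul s).symm.trans (mem_quotientDual.1 hf s hs))

theorem exists_injective_pi_of_isArtinian (hE : IsCogenerator R E) [IsArtinian R M] :
    ∃ s : Finset (M →ₗ[R] E),
      Function.Injective (LinearMap.pi fun f : s => (f : M →ₗ[R] E)) := by
  classical
  obtain ⟨_, ⟨s, rfl⟩, hmin⟩ := IsArtinian.set_has_minimal
    (Set.range fun s : Finset (M →ₗ[R] E) => ⨅ f ∈ s, LinearMap.ker f) (Set.range_nonempty _)
  refine ⟨s, (injective_iff_map_eq_zero _).2 fun x hx => ?_⟩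
  by_contra hx0
  obtain ⟨g, hg⟩ := hE M x hx0
  refine hmin _ ⟨insert g s, rfl⟩ (SetLike.lt_iff_le_and_exists.2
    ⟨biInf_mono fun f hf => Finset.mem_insert_of_mem hf, x, ?_, fun hx' => hg ?_⟩)
  · simp only [Submodule.mem_iInf, LinearMap.mem_ker]
    exact fun f hf => congrFun hx ⟨f, hf⟩
  · simp only [Submodule.mem_iInf] at hx'
    exact hx' g (Finset.mem_insert_self g s)

end IsCogenerator

end Cogenerator

section Injective

variable {R : Type u} [CommRing R] {E : Type u} [AddCommGroup E] [Module R E]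
  [Module.Injective R E] {N M P : Type u} [AddCommGroup N] [Module R N] [AddCommGroup M]
  [Module R M] [AddCommGroup P] [Module R P]

theorem lcomp_surjective_of_injective {f : N →ₗ[R] M} (hf : Function.Injective f) :
    Function.Surjective (LinearMap.lcomp R E f) :=
  Module.Injective.extension_property R E N M f hf

theorem exact_lcomp_of_exact {f : N →ₗ[R] M} {g : M →ₗ[R] P} (h : Function.Exact f g) :
    Function.Exact (LinearMap.lcomp R E g) (LinearMap.lcomp R E f) := by
  have hrange : Function.Exact f g.rangeRestrict := fun x => by
    rw [← h x, ← Subtype.coe_inj]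
    rfl
  intro φ
  rw [LinearMap.exact_lcomp_of_exact_of_surjective E hrange g.surjective_rangeRestrict φ]
  constructor
  · rintro ⟨ψ, rfl⟩
    obtain ⟨ψ', rfl⟩ := lcomp_surjective_of_injective (LinearMap.range g).injective_subtype ψ
    exact ⟨ψ', rfl⟩
  · rintro ⟨ψ, rfl⟩
    exact ⟨ψ ∘ₗ (LinearMap.range g).subtype, rfl⟩

theorem biduality_surjective_of_exact {f : N →ₗ[R] M} {g : M →ₗ[R] P}
    (hfg : Function.Exact f g) (hg : Function.Surjective g)
    (hN : Function.Surjective (biduality (R := R) E N))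
    (hP : Function.Surjective (biduality (R := R) E P)) :
    Function.Surjective (biduality (R := R) E M) := by
  have hg' : Function.Surjective (LinearMap.lcomp R E (LinearMap.lcomp R E g)) :=
    lcomp_surjective_of_injective (LinearMap.lcomp_injective_of_surjective g hg)
  exact LinearMap.surjective_of_surjective_of_surjective_of_injective
    f g (0 : P →ₗ[R] PUnit.{u + 1}) (LinearMap.lcomp R E (LinearMap.lcomp R E f))
    (LinearMap.lcomp R E (LinearMap.lcomp R E g)) (0 : _ →ₗ[R] PUnit.{u + 1})
    (biduality E N) (biduality E M) (biduality E P) LinearMap.id rfl rfl rfl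
    ((LinearMap.exact_zero_iff_surjective _ g).2 hg)
    (exact_lcomp_of_exact (exact_lcomp_of_exact hfg))
    ((LinearMap.exact_zero_iff_surjective _ _).2 hg') hN hP Function.injective_id

theorem biduality_surjective_of_surjective {q : M →ₗ[R] P} (hq : Function.Surjective q)
    (hM : Function.Surjective (biduality (R := R) E M)) :
    Function.Surjective (biduality (R := R) E P) :=
  biduality_surjective_of_exact (g := (0 : P →ₗ[R] PUnit.{u + 1}))
    ((LinearMap.exact_zero_iff_surjective _ q).2 hq) (fun _ => ⟨0, rfl⟩) hM
    biduality_surjective_of_subsingleton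

theorem biduality_surjective_of_finite [IsNoetherianRing R]
    (hR : Function.Surjective (biduality (R := R) E R)) [Module.Finite R M] :
    Function.Surjective (biduality (R := R) E M) := by
  induction ‹Module.Finite R M› using IsNoetherianRing.induction_on_isQuotientEquivQuotientPrime R
  with
  | subsingleton => exact biduality_surjective_of_subsingleton
  | quotient N p e =>
    exact biduality_surjective_of_surjective (q := e.symm.toLinearMap ∘ₗ p.1.mkQ)
      (e.symm.surjective.comp p.1.mkQ_surjective) hR
  | exact N₁ N₂ N₃ f g _ hg hfg h₁ h₃ => exact biduality_surjective_of_exact hfg hg h₁ h₃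

theorem isCogenerator_of_forall_isMaximal
    (h : ∀ m : Ideal R, m.IsMaximal → ∃ ι : (R ⧸ m) →ₗ[R] E, ι 1 ≠ 0) : IsCogenerator R E := by
  intro M _ _ x hx
  have hann : LinearMap.ker (LinearMap.toSpanSingleton R M x) ≠ ⊤ := fun htop =>
    hx (by simpa using (Ideal.eq_top_iff_one _).1 htop)
  obtain ⟨m, hm, hle⟩ := Ideal.exists_le_maximal _ hann
  obtain ⟨ι, hι⟩ := h m hm
  obtain ⟨f, hf⟩ := (exact_lcomp_of_exact
    (LinearMap.exact_subtype_ker_map (LinearMap.toSpanSingleton R M x)) (ι ∘ₗ m.mkQ)).1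
    (LinearMap.ext fun r =>
      (congrArg ι ((Submodule.Quotient.mk_eq_zero m).2 (hle r.2))).trans (map_zero ι))
  have hf1 : f x = ι 1 := by simpa using LinearMap.congr_fun hf 1
  exact ⟨f, hf1 ▸ hι⟩

theorem IsCogenerator.finite_dual_of_isArtinian (hE : IsCogenerator R E)
    [Module.Finite R (E →ₗ[R] E)] [IsArtinian R M] :
    Module.Finite R (MatlisDual (R := R) E M) := by
  classical
  obtain ⟨s, hs⟩ := hE.exists_injective_pi_of_isArtinian (M := M)
  have : Module.Finite R ((s → E) →ₗ[R] E) :=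
    Module.Finite.equiv (LinearMap.lsum R (fun _ : s => E) R)
  exact Module.Finite.of_surjective _ (lcomp_surjective_of_injective hs)

end Injective

section MatlisDuality

/-- The form of Matlis duality on which the correspondence of cores and hulls rests: `E` is a
cogenerator, finitely generated modules are reflexive (injectivity of the evaluation map being a
consequence of the first condition), and duals of Artinian modules are finitely generated. -/
structure IsMatlisDualizing (R : Type u) [CommRing R] (E : Type u) [AddCommGroup E]
    [Module R E] : Prop where
  isCogenerator : IsCogenerator R E
  biduality_surjective (M : Type u) [AddCommGroup M] [Module R M] [Module.Finite R M] :
    Function.Surjective (biduality (R := R) E M)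
  finite_dual (B : Type u) [AddCommGroup B] [Module R B] [IsArtinian R B] :
    Module.Finite R (MatlisDual (R := R) E B)

variable {R : Type u} [CommRing R] {E : Type u} [AddCommGroup E] [Module R E]

theorem IsMatlisDualizing.isArtinian_dual [IsNoetherianRing R] (hE : IsMatlisDualizing R E)
    (M : Type u) [AddCommGroup M] [Module R M] [Module.Finite R M] :
    IsArtinian R (MatlisDual (R := R) E M) :=
  hE.isCogenerator.isArtinian_dual (hE.biduality_surjective M)

theorem IsMatlisDualizing.biduality_bijective_of_isArtinian (hE : IsMatlisDualizing R E)
    (B : Type u) [AddCommGroup B] [Module R B] [IsArtinian R B] :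
    Function.Bijective (biduality (R := R) E B) :=
  have := hE.finite_dual B
  ⟨hE.isCogenerator.biduality_injective,
    hE.isCogenerator.biduality_surjective_of_dual (hE.biduality_surjective _)⟩

theorem exists_forall_apply_eq_smul_of_biduality_surjective {I : Ideal R}
    (hI : Function.Surjective (biduality (R := R) E (R ⧸ I))) (φ : E →ₗ[R] E) :
    ∃ r : R, ∀ x : E, (∀ s ∈ I, s • x = 0) → φ x = r • x := by
  obtain ⟨y, hy⟩ := hI (φ ∘ₗ LinearMap.applyₗ (Submodule.Quotient.mk 1))
  obtain ⟨r, rfl⟩ := Submodule.Quotient.mk_surjective I y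
  refine ⟨r, fun x hx => ?_⟩
  have h := LinearMap.congr_fun hy (I.liftQ (LinearMap.toSpanSingleton R E x) hx)
  have h1 : φ ((1 : R) • x) = r • x := h.symm
  rwa [one_smul] at h1

theorem biduality_self_surjective_of_forall_end
    (h : ∀ φ : E →ₗ[R] E, ∃ r : R, ∀ x, φ x = r • x) :
    Function.Surjective (biduality (R := R) E R) := by
  intro F
  obtain ⟨r, hr⟩ := h (F ∘ₗ (LinearMap.ringLmapEquivSelf R R E).symm.toLinearMap)
  refine ⟨r, LinearMap.ext fun f => ?_⟩
  have hf : (LinearMap.ringLmapEquivSelf R R E).symm (f 1) = f :=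
    (LinearMap.ringLmapEquivSelf R R E).symm_apply_apply f
  calc biduality E R r f = r • f 1 := by rw [biduality_apply, ← map_smul, smul_eq_mul, mul_one]
    _ = F f := by rw [← hr, LinearMap.comp_apply, LinearEquiv.coe_coe, hf]

end MatlisDuality

section EssentialExtension

open IsLocalRing

variable {R : Type u} [CommRing R] {K : Type u} [AddCommGroup K] [Module R K]
  {E : Type u} [AddCommGroup E] [Module R E] {ι : K →ₗ[R] E}

theorem range_le_of_essential [IsSimpleModule R K]
    (hess : ∀ N : Submodule R E, N ≠ ⊥ → LinearMap.range ι ⊓ N ≠ ⊥)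
    {N : Submodule R E} (hN : N ≠ ⊥) : LinearMap.range ι ≤ N := by
  rw [LinearMap.range_le_iff_comap]
  refine (eq_bot_or_eq_top (N.comap ι)).resolve_left fun h => hess N hN ?_
  rw [← Submodule.map_comap_eq, h, Submodule.map_bot]

theorem mem_range_of_forall_maximalIdeal_smul_eq_zero [IsLocalRing R]
    (hess : ∀ N : Submodule R E, N ≠ ⊥ → LinearMap.range ι ⊓ N ≠ ⊥)
    {x : E} (hx : ∀ r ∈ maximalIdeal R, r • x = 0) : x ∈ LinearMap.range ι := by
  obtain rfl | hx0 := eq_or_ne x 0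
  · exact Submodule.zero_mem _
  obtain ⟨y, ⟨hy, hyx⟩, hy0⟩ :=
    (Submodule.ne_bot_iff _).1 (hess (R ∙ x) (by simpa using hx0))
  obtain ⟨r, rfl⟩ := Submodule.mem_span_singleton.1 hyx
  have hr : IsUnit r := not_not.1 fun h => hy0 (hx r h)
  exact (Submodule.smul_mem_iff_of_isUnit _ hr).1 hy

theorem iInf_pow_smul_eq_bot_of_fg [IsLocalRing R] [IsNoetherianRing R] {I : Ideal R}
    (hI : I ≠ ⊤) {N : Submodule R E} (hN : N.FG) : ⨅ n : ℕ, I ^ n • N = ⊥ := by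
  have := Module.Finite.iff_fg.2 hN
  have hmap (n : ℕ) : I ^ n • N = (I ^ n • (⊤ : Submodule R N)).map N.subtype := by
    rw [Submodule.map_smul'', Submodule.map_subtype_top]
  simp_rw [hmap]
  rw [← Submodule.map_iInf _ N.injective_subtype, I.iInf_pow_smul_eq_bot_of_isLocalRing hI,
    Submodule.map_bot]

theorem exists_pow_smul_eq_zero_of_essential [IsLocalRing R] [IsNoetherianRing R]
    [IsSimpleModule R K] (hι : Function.Injective ι)
    (hess : ∀ N : Submodule R E, N ≠ ⊥ → LinearMap.range ι ⊓ N ≠ ⊥) (x : E) :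
    ∃ n : ℕ, ∀ r ∈ maximalIdeal R ^ n, r • x = 0 := by
  by_contra! hx
  have hle (n : ℕ) : LinearMap.range ι ≤ maximalIdeal R ^ n • (R ∙ x) := by
    obtain ⟨r, hr, hrx⟩ := hx n
    exact range_le_of_essential hess ((Submodule.ne_bot_iff _).2
      ⟨r • x, Submodule.smul_mem_smul hr (Submodule.mem_span_singleton_self x), hrx⟩)
  have hbot : LinearMap.range ι = ⊥ := by
    rw [eq_bot_iff, ← iInf_pow_smul_eq_bot_of_fg (maximalIdeal.isMaximal R).ne_top
      (Submodule.fg_span_singleton x)]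
    exact le_iInf hle
  have := IsSimpleModule.nontrivial R K
  obtain ⟨a, ha⟩ := exists_ne (0 : K)
  exact ha (hι (by rw [LinearMap.range_eq_bot.1 hbot, LinearMap.zero_apply, map_zero]))

end EssentialExtension

section InjectiveHull

open IsLocalRing

variable {R : Type u} [CommRing R] [IsLocalRing R] {E : Type u} [AddCommGroup E] [Module R E]

theorem maximalIdeal_smul_residueField_eq_zero {r : R} (hr : r ∈ maximalIdeal R)
    (x : ResidueField R) : r • x = 0 := by
  rw [Algebra.smul_def, ResidueField.algebraMap_eq, (residue_eq_zero_iff r).2 hr, zero_mul]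

theorem isFiniteLength_quotient_maximalIdeal_pow [IsNoetherianRing R] (n : ℕ) :
    IsFiniteLength R (R ⧸ maximalIdeal R ^ n) := by
  obtain rfl | hn := eq_or_ne n 0
  · have : Subsingleton (R ⧸ maximalIdeal R ^ 0) :=
      Ideal.Quotient.subsingleton_iff.2 ((pow_zero _).trans Ideal.one_eq_top)
    exact .of_subsingleton
  have hmin : maximalIdeal R ∈ (maximalIdeal R ^ n).minimalPrimes := by
    rw [← Ideal.radical_minimalPrimes, Ideal.radical_pow _ hn,
      (maximalIdeal.isMaximal R).isPrime.radical, Ideal.minimalPrimes_eq_subsingleton_self]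
    rfl
  have := quotient_artinian_of_mem_minimalPrimes_of_isLocalRing _ hmin
  exact isFiniteLength_iff_isNoetherian_isArtinian.2 ⟨inferInstance,
    isArtinian_of_surjective_algebraMap
      (Ideal.Quotient.mk_surjective (I := maximalIdeal R ^ n))⟩

namespace IsInjectiveHull

theorem isCogenerator (hE : IsInjectiveHull R (ResidueField R) E) : IsCogenerator R E := by
  obtain ⟨_, ι, hι, -⟩ := hE
  refine isCogenerator_of_forall_isMaximal fun m hm => ?_
  obtain rfl := eq_maximalIdeal hm
  exact ⟨ι, (map_ne_zero_iff ι hι).2 (one_ne_zero (α := ResidueField R))⟩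

theorem biduality_residueField_surjective (hE : IsInjectiveHull R (ResidueField R) E) :
    Function.Surjective (biduality (R := R) E (ResidueField R)) := by
  obtain ⟨-, ι, -, hess⟩ := hE
  have hkill {r : R} (hr : r ∈ maximalIdeal R) (f : ResidueField R →ₗ[R] E) : r • f = 0 :=
    LinearMap.ext fun y => by
      rw [LinearMap.smul_apply, ← map_smul, maximalIdeal_smul_residueField_eq_zero hr, map_zero,
        LinearMap.zero_apply]
  have hdual (f : ResidueField R →ₗ[R] E) : ∃ c : R, f = c • ι := by
    obtain ⟨c, hc⟩ := mem_range_of_forall_maximalIdeal_smul_eq_zero hess (x := f 1) fun r hr =>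
      LinearMap.congr_fun (hkill hr f) 1
    obtain ⟨c, rfl⟩ := residue_surjective c
    refine ⟨c, Submodule.linearMap_qext _ (LinearMap.ext_ring ?_)⟩
    calc f 1 = ι (c • 1) := by
          rw [← hc, Algebra.smul_def, ResidueField.algebraMap_eq, mul_one]
      _ = (c • ι) 1 := map_smul ι c 1
  intro F
  obtain ⟨d, hd⟩ := mem_range_of_forall_maximalIdeal_smul_eq_zero hess (x := F ι) fun r hr => by
    rw [← map_smul, hkill hr, map_zero]
  refine ⟨d, LinearMap.ext fun f => ?_⟩
  obtain ⟨c, rfl⟩ := hdual f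
  rw [biduality_apply, LinearMap.smul_apply, hd, map_smul]

theorem biduality_surjective_of_isFiniteLength (hE : IsInjectiveHull R (ResidueField R) E)
    {M : Type u} [AddCommGroup M] [Module R M] (hM : IsFiniteLength R M) :
    Function.Surjective (biduality (R := R) E M) := by
  have := hE.1
  induction hM with
  | of_subsingleton => exact biduality_surjective_of_subsingleton
  | @of_simple_quotient M _ _ N _ _ hN =>
    obtain ⟨m, hm, ⟨e⟩⟩ := isSimpleModule_iff_quot_maximal.1 ‹IsSimpleModule R (M ⧸ N)›
    obtain rfl := eq_maximalIdeal hm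
    exact biduality_surjective_of_exact (LinearMap.exact_subtype_mkQ N) N.mkQ_surjective hN
      (biduality_surjective_of_surjective (M := ResidueField R) (q := e.symm.toLinearMap)
        e.symm.surjective hE.biduality_residueField_surjective)

variable [IsNoetherianRing R] [IsPrecomplete (maximalIdeal R) R]

theorem exists_forall_end_apply_eq_smul (hE : IsInjectiveHull R (ResidueField R) E)
    (φ : E →ₗ[R] E) : ∃ r : R, ∀ x, φ x = r • x := by
  choose r hr using fun n : ℕ => exists_forall_apply_eq_smul_of_biduality_surjective
    (hE.biduality_surjective_of_isFiniteLength (isFiniteLength_quotient_maximalIdeal_pow n)) φ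
  have hcauchy {m n : ℕ} (hmn : m ≤ n) :
      r m ≡ r n [SMOD (maximalIdeal R ^ m • ⊤ : Submodule R R)] := by
    rw [SModEq.sub_mem, smul_eq_mul, Ideal.mul_top]
    refine hE.isCogenerator.mem_of_forall_smul_eq_zero fun x hx => ?_
    rw [sub_smul, ← hr m x hx, ← hr n x fun s hs => hx s (Ideal.pow_le_pow_right hmn hs), sub_self]
  obtain ⟨a, ha⟩ := IsPrecomplete.prec' (I := maximalIdeal R) r hcauchy
  refine ⟨a, fun x => ?_⟩
  obtain ⟨-, ι, hι, hess⟩ := hE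
  have : IsSimpleModule R (ResidueField R) :=
    isSimpleModule_iff_quot_maximal.2 ⟨_, maximalIdeal.isMaximal R, ⟨.refl R _⟩⟩
  obtain ⟨n, hn⟩ := exists_pow_smul_eq_zero_of_essential hι hess x
  have hna : r n - a ∈ maximalIdeal R ^ n := by
    simpa only [SModEq.sub_mem, smul_eq_mul, Ideal.mul_top] using ha n
  rw [hr n x hn, ← sub_eq_zero, ← sub_smul, hn _ hna]

theorem isMatlisDualizing (hE : IsInjectiveHull R (ResidueField R) E) :
    IsMatlisDualizing R E where
  isCogenerator := hE.isCogenerator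
  biduality_surjective _ _ _ _ :=
    have := hE.1
    biduality_surjective_of_finite
      (biduality_self_surjective_of_forall_end hE.exists_forall_end_apply_eq_smul)
  finite_dual _ _ _ _ :=
    have := hE.1
    have : Module.Finite R (E →ₗ[R] E) :=
      Module.Finite.of_surjective (LinearMap.lsmul R E) fun φ =>
        (hE.exists_forall_end_apply_eq_smul φ).imp fun _ hr =>
          LinearMap.ext fun x => (hr x).symm
    hE.isCogenerator.finite_dual_of_isArtinian

end IsInjectiveHull

end InjectiveHull

section Interior

variable {R : Type u} [CommRing R] {i : Selector R}
  {B : Type u} [AddCommGroup B] [Module R B]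

/-- The interior `i(C)` of a submodule `C ⊆ B`, as a submodule of `B` instead of `C`. -/
def interiorIn (i : Selector R) {B : Type u} [AddCommGroup B] [Module R B]
    (C : Submodule R B) : Submodule R B :=
  (i C).map C.subtype

theorem interiorIn_le (C : Submodule R B) : interiorIn i C ≤ C :=
  Submodule.map_subtype_le _ _

namespace IsInteriorOnArtinian

theorem interiorIn_range (hi : IsInteriorOnArtinian i) [IsArtinian R B]
    {X : Type u} [AddCommGroup X] [Module R X] {g : X →ₗ[R] B} (hg : Function.Injective g) :
    interiorIn i (LinearMap.range g) = (i X).map g := by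
  have := isArtinian_of_injective g hg
  rw [interiorIn, ← hi.map_equiv X _ (LinearEquiv.ofInjective g hg), ← Submodule.map_comp]
  rfl

theorem interiorIn_map (hi : IsInteriorOnArtinian i)
    {B' : Type u} [AddCommGroup B'] [Module R B'] [IsArtinian R B'] {g : B →ₗ[R] B'}
    (hg : Function.Injective g) (C : Submodule R B) :
    interiorIn i (C.map g) = (interiorIn i C).map g := by
  have h := hi.interiorIn_range (g := g ∘ₗ C.subtype) (hg.comp C.injective_subtype)
  rwa [LinearMap.range_comp, Submodule.range_subtype, Submodule.map_comp] at h

theorem interiorIn_mono (hi : IsInteriorOnArtinian i) [IsArtinian R B]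
    {C D : Submodule R B} (h : C ≤ D) : interiorIn i C ≤ interiorIn i D :=
  calc interiorIn i C = ((i C).map (Submodule.inclusion h)).map D.subtype := by
        rw [← Submodule.map_comp, Submodule.subtype_comp_inclusion, interiorIn]
    _ ≤ interiorIn i D := by
        rw [← hi.interiorIn_range (Submodule.inclusion_injective h)]
        exact Submodule.map_mono (hi.mono D _)

theorem interiorIn_idem (hi : IsInteriorOnArtinian i) [IsArtinian R B] (C : Submodule R B) :
    interiorIn i (interiorIn i C) = interiorIn i C :=
  calc interiorIn i (interiorIn i C) = (interiorIn i (i C)).map C.subtype :=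
        hi.interiorIn_map C.injective_subtype _
    _ = interiorIn i C := congrArg _ (hi.idem C)

end IsInteriorOnArtinian

end Interior

section DualClosure

/-- The closure operation dual to `i`: the closure of `L` in `M` is the common kernel of the maps in
the interior of `(M/L)^∨ ⊆ M^∨`. -/
def dualClosure {R : Type u} [CommRing R] (E : Type u) [AddCommGroup E] [Module R E]
    (i : Selector R) : ClosureAssignment R :=
  fun _ _ _ L => coannihilator (interiorIn i (quotientDual E L))

variable {R : Type u} [CommRing R] [IsNoetherianRing R] {E : Type u} [AddCommGroup E] [Module R E]
  {i : Selector R} {M P : Type u} [AddCommGroup M] [Module R M] [Module.Finite R M]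
  [AddCommGroup P] [Module R P] {B : Type u} [AddCommGroup B] [Module R B] [IsArtinian R B]

theorem dualClosure_ker (hE : IsMatlisDualizing R E) (hi : IsInteriorOnArtinian i)
    {q : M →ₗ[R] P} (hq : Function.Surjective q) :
    dualClosure E i M (LinearMap.ker q) = (dualSelector E i P).comap q := by
  have := hE.isArtinian_dual M
  rw [dualClosure, ← range_lcomp_of_surjective hq,
    hi.interiorIn_range (LinearMap.lcomp_injective_of_surjective q hq), coannihilator_map_lcomp]
  rfl

theorem dualClosure_bot (hE : IsMatlisDualizing R E) (hi : IsInteriorOnArtinian i) :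
    dualClosure E i M ⊥ = dualSelector E i M := by
  have h := dualClosure_ker hE hi (q := (LinearMap.id : M →ₗ[R] M)) Function.surjective_id
  rwa [LinearMap.ker_id, Submodule.comap_id] at h

theorem isDualClosure_dualClosure (hE : IsMatlisDualizing R E) (hi : IsInteriorOnArtinian i) :
    IsDualClosure E i (dualClosure E i) where
  le_cl M _ _ _ L := le_quotientDual_iff.1 (interiorIn_le _)
  idem M _ _ _ L := by
    have := hE.isArtinian_dual M
    simp only [dualClosure,
      hE.isCogenerator.quotientDual_coannihilator (hE.biduality_surjective M), hi.interiorIn_idem]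
  mono M _ _ _ L N h := by
    have := hE.isArtinian_dual M
    exact coannihilator_antitone (hi.interiorIn_mono (quotientDual_antitone h))
  residual M P _ _ _ _ _ _ q hq := by rw [dualClosure_ker hE hi hq, dualClosure_bot hE hi]
  cl_bot M _ _ _ := dualClosure_bot hE hi

namespace IsDualClosure

variable {cl : ClosureAssignment R}

theorem eq_dualClosure (hcl : IsDualClosure E i cl) (hE : IsMatlisDualizing R E)
    (hi : IsInteriorOnArtinian i) (L : Submodule R M) : cl M L = dualClosure E i M L := by
  have h := hcl.residual M (M ⧸ L) L.mkQ L.mkQ_surjective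
  rwa [hcl.cl_bot, ← dualClosure_ker hE hi L.mkQ_surjective, Submodule.ker_mkQ] at h

theorem apply_quotientDual (hcl : IsDualClosure E i cl) (hE : IsMatlisDualizing R E)
    (hi : IsInteriorOnArtinian i) (C : Submodule R B) :
    cl (MatlisDual (R := R) E B) (quotientDual E C) = quotientDual E (interiorIn i C) := by
  have := hE.finite_dual B
  have := hE.isArtinian_dual (MatlisDual (R := R) E B)
  have hB := hE.biduality_bijective_of_isArtinian B
  rw [hcl.eq_dualClosure hE hi, dualClosure, hE.isCogenerator.quotientDual_quotientDual hB.2,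
    hi.interiorIn_map hB.1, coannihilator_map_biduality]

theorem isReduction_quotientDual_iff (hcl : IsDualClosure E i cl) (hE : IsMatlisDualizing R E)
    (hi : IsInteriorOnArtinian i) {A C : Submodule R B} :
    IsReduction cl (quotientDual E A) (quotientDual E C) ↔ IsExpansion i A C := by
  rw [IsReduction, hcl.apply_quotientDual hE hi, hcl.apply_quotientDual hE hi,
    hE.isCogenerator.quotientDual_le_quotientDual_iff,
    hE.isCogenerator.quotientDual_injective.eq_iff, eq_comm]
  rfl

theorem core_quotientDual (hcl : IsDualClosure E i cl) (hE : IsMatlisDualizing R E)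
    (hi : IsInteriorOnArtinian i) (A : Submodule R B) :
    core cl (quotientDual E A) = quotientDual E (hull i A) := by
  refine le_antisymm ?_ (le_sInf fun L hL => ?_)
  · refine le_quotientDual_iff.2 (sSup_le fun C hC => le_quotientDual_iff.1 (sInf_le ?_))
    exact (hcl.isReduction_quotientDual_iff hE hi).2 hC
  · have := hE.finite_dual B
    obtain ⟨C, rfl⟩ : ∃ C : Submodule R B, quotientDual E C = L :=
      ⟨_, hE.isCogenerator.quotientDual_coannihilator
        (hE.biduality_bijective_of_isArtinian B).2 L⟩
    exact quotientDual_antitone (le_sSup ((hcl.isReduction_quotientDual_iff hE hi).1 hL))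

end IsDualClosure

end DualClosure

end CoreHull

theorem theorem5_general (R : Type u) [CommRing R] [IsNoetherianRing R]
    (E : Type u) [AddCommGroup E] [Module R E] (hE : CoreHull.IsMatlisDualizing R E)
    (i : CoreHull.Selector R) (hi : CoreHull.IsInteriorOnArtinian i) :
    (∃ cl : CoreHull.ClosureAssignment R, CoreHull.IsDualClosure E i cl) ∧
    ∀ cl : CoreHull.ClosureAssignment R, CoreHull.IsDualClosure E i cl →
      ∀ (B : Type u) [AddCommGroup B] [Module R B] [IsArtinian R B] (A : Submodule R B),
        Function.Bijective (CoreHull.biduality (R := R) E B) ∧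
        CoreHull.quotientDual (R := R) E (CoreHull.core cl (CoreHull.quotientDual (R := R) E A)) =
          (CoreHull.hull i A).map (CoreHull.biduality (R := R) E B) := by
  refine ⟨⟨_, CoreHull.isDualClosure_dualClosure hE hi⟩, fun cl hcl B _ _ _ A => ?_⟩
  have hB := hE.biduality_bijective_of_isArtinian B
  refine ⟨hB, ?_⟩
  rw [hcl.core_quotientDual hE hi, hE.isCogenerator.quotientDual_quotientDual hB.2]

theorem theorem5 (R : Type u) [CommRing R] [IsLocalRing R] [IsNoetherianRing R]
    [IsAdicComplete (IsLocalRing.maximalIdeal R) R]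
    (E : Type u) [AddCommGroup E] [Module R E]
    (hE : CoreHull.IsInjectiveHull R (IsLocalRing.ResidueField R) E)
    (i : CoreHull.Selector R) (hi : CoreHull.IsNakayamaInterior i) :
    (∃ cl : CoreHull.ClosureAssignment R, CoreHull.IsDualClosure E i cl) ∧
    ∀ cl : CoreHull.ClosureAssignment R, CoreHull.IsDualClosure E i cl →
      ∀ (B : Type u) [AddCommGroup B] [Module R B] [IsArtinian R B] (A : Submodule R B),
        Function.Bijective (CoreHull.biduality (R := R) E B) ∧
        CoreHull.quotientDual (R := R) E
            (CoreHull.core cl (CoreHull.quotientDual (R := R) E A)) =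
          (CoreHull.hull i A).map (CoreHull.biduality (R := R) E B) :=
  theorem5_general R E hE.isMatlisDualizing i hi.toIsInteriorOnArtinian
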